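/- All spaces are Tychonoff. A space is zero-dimensional if it has a base of clopen sets. It is M-scattered if every nonempty subspace $A$ of it contains a nonempty relatively open subset of $A$ that is second-countable. A compact space is Corson compact if, for some set $\Gamma$, it is homeomorphic to a subspace of $\Sigma([0,1]^\Gamma)=\{x\in[0,1]^\Gamma : |\{\gamma\in\Gamma : x_\gamma\neq 0\}|\le\omega\}$. A family $\mathscr{U}$ of subsets of $X$ is point-finite (point-countable) if every $x\in X$ belongs to only finitely (countably) many members of $\mathscr{U}$; it is $T_0$-separating if for any distinct $x,y\in X$ there is $U\in\mathscr{U}$ with $|U\cap\{x,y\}|=1$; it is block-point-finite if for some set $\Gamma$ one can write $\mathscr{U}=\bigcup_{\gamma\in\Gamma}\mathscr{U}_\gamma$, where each $\mathscr{U}_\gamma$ is countable and for every $x\in X$ the set $\{\gamma\in\Gamma : x\in\bigcup\mathscr{U}_\gamma\}$ is finite. A family $\mathscr{V}$ refines $\mathscr{U}$ if every $V\in\mathscr{V}$ is contained in some $U\in\mathscr{U}$. Let $K$ be a compact space. (1) If $K$ is zero-dimensional, M-scattered and Corson compact, then $K$ has a $T_0$-separating block-point-finite family of clopen subsets of $K$.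 (2) If $\mathscr{U}$ is a point-countable family of M-scattered clopen subsets of $K$, then there is a point-finite family $\mathscr{V}$ of clopen subsets of $K$ such that $\mathscr{V}$ refines $\mathscr{U}$ and $\bigcup\mathscr{V}=\bigcup\mathscr{U}$. -/

import Mathlib

open Set Topology TopologicalSpace

universe u v

/-- A base of clopen sets. -/
def IsZeroDimensional (X : Type u) [TopologicalSpace X] : Prop :=
  IsTopologicalBasis {s : Set X | IsClopen s}

/-- The `Σ`-product of unit intervals: the points of `[0,1]^Γ` with countable support. -/
def sigmaProduct (Γ : Type v) : Set (Γ → unitInterval) :=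
  {x | {γ | x γ ≠ 0}.Countable}

/-- Corson compact: compact and homeomorphic to a subspace of some `Σ([0,1]^Γ)`. -/
def IsCorsonCompact (X : Type u) [TopologicalSpace X] : Prop :=
  CompactSpace X ∧
    ∃ (Γ : Type v) (h : X → Γ → unitInterval), IsEmbedding h ∧ range h ⊆ sigmaProduct Γ

/-- Every nonempty subspace has a nonempty relatively open subset of countable weight. -/
def IsMScattered (X : Type u) [TopologicalSpace X] : Prop :=
  ∀ A : Set X, A.Nonempty →
    ∃ U : Set X, IsOpen U ∧ (A ∩ U).Nonempty ∧ SecondCountableTopology (A ∩ U : Set X)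

/-- Any two distinct points are distinguished by a member that contains exactly one of them. -/
def IsT0Separating {X : Type u} (𝒰 : Set (Set X)) : Prop :=
  ∀ x y : X, x ≠ y → ∃ U ∈ 𝒰, Xor (x ∈ U) (y ∈ U)

def IsPointFinite {X : Type u} (𝒰 : Set (Set X)) : Prop :=
  ∀ x : X, {U | U ∈ 𝒰 ∧ x ∈ U}.Finite

def IsPointCountable {X : Type u} (𝒰 : Set (Set X)) : Prop :=
  ∀ x : X, {U | U ∈ 𝒰 ∧ x ∈ U}.Countable

/-- The family splits into countable blocks whose unions form a point-finite family. Unions of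
blocks are counted as an indexed family, so that different blocks count separately even if they
have the same union. -/
def IsBlockPointFinite {X : Type u} (𝒰 : Set (Set X)) : Prop :=
  ∃ (Γ : Type u) (B : Γ → Set (Set X)),
    𝒰 = ⋃ γ, B γ ∧ (∀ γ, (B γ).Countable) ∧ ∀ x : X, {γ | x ∈ ⋃₀ B γ}.Finite

/-- `𝒱` refines `𝒰`: every member of `𝒱` is contained in a member of `𝒰`. -/
def Refines {X : Type u} (𝒱 𝒰 : Set (Set X)) : Prop :=
  ∀ V ∈ 𝒱, ∃ U ∈ 𝒰, V ⊆ U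

/-! Both parts rest on `IsPointCountable.isBlockPointFinite`. Build open stages in `K`, each adding
the open sets that are separable modulo earlier stages; M-scatteredness makes them cover `⋃₀ 𝒰`. A
compact `Y ⊆ ⋃₀ 𝒰` has a first stage containing it, and what earlier stages leave of `Y` lies in the
closure of a countable set `c Y`. Cutting `Y` by a clopen `V` that misses `c Y` lowers its rank,
while point-countability lets only countably many members of `𝒰` meet `c Y`. As ordinals are
well-founded, no infinite sequence of members through one point can have each member miss the `c` of
the intersection of its predecessors. `exists_countable_blocks` turns this into countable blocks.

For (2), the members of each block are then made disjoint. For (1), the family comes from clopen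
sets between rational levels of the Corson coordinates. -/

/-! ### Closing-off arguments and splitting into countable blocks -/

section Combinatorics

open Cardinal

/-- Closing a set under an operator that sends finite sets to countable sets does not increase
its cardinality beyond `ℵ₀`. -/
theorem exists_closed_superset {ι : Type u} (T : Set ι → Set ι)
    (hT : ∀ s, s.Finite → (T s).Countable) (B : Set ι) :
    ∃ C, B ⊆ C ∧ (∀ s ⊆ C, s.Finite → T s ⊆ C) ∧ #C ≤ max #B ℵ₀ := by
  classical
  let step : Set ι → Set ι := fun C => C ∪ ⋃ s : Finset C, T (Subtype.val '' (s : Set C))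
  let F : ℕ → Set ι := fun n => step^[n] B
  have hF : ∀ n, F (n + 1) = step (F n) := fun n => Function.iterate_succ_apply' _ _ _
  have hmono : Monotone F := monotone_nat_of_le_succ fun n => by
    rw [hF]; exact subset_union_left
  refine ⟨⋃ n, F n, subset_iUnion F 0, ?_, ?_⟩
  · intro s hs hfin
    obtain ⟨n, hn⟩ : ∃ n, s ⊆ F n := by
      induction s, hfin using Set.Finite.induction_on with
      | empty => exact ⟨0, empty_subset _⟩
      | insert _ _ ih =>
        rw [insert_subset_iff] at hs
        obtain ⟨n, hn⟩ := ih hs.2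
        obtain ⟨m, hm⟩ := mem_iUnion.1 hs.1
        exact ⟨max n m, insert_subset (hmono (le_max_right _ _) hm)
          (hn.trans (hmono (le_max_left _ _)))⟩
    refine Subset.trans ?_ (subset_iUnion F (n + 1))
    rw [hF]
    refine Subset.trans ?_ subset_union_right
    have hfin' : (Subtype.val ⁻¹' s : Set (F n)).Finite :=
      hfin.preimage Subtype.val_injective.injOn
    refine Subset.trans ?_ (subset_iUnion _ hfin'.toFinset)
    rw [Finite.coe_toFinset, Subtype.image_preimage_coe, inter_eq_right.2 hn]
  · have hstep : ∀ C : Set ι, #C ≤ max #B ℵ₀ → #(step C) ≤ max #B ℵ₀ := by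
      intro C hC
      have hω : ℵ₀ ≤ max #B ℵ₀ := le_max_right _ _
      have hfs : #(Finset C) ≤ max #B ℵ₀ := by
        cases finite_or_infinite C
        · exact (mk_le_aleph0 (α := Finset C)).trans hω
        · rw [mk_finset_of_infinite]; exact hC
      refine (mk_union_le _ _).trans (add_le_of_le hω hC ?_)
      refine (mk_iUnion_le _).trans ((mul_le_mul' hfs (ciSup_le' fun s => ?_)).trans
        (mul_eq_self hω).le)
      exact (le_aleph0_iff_set_countable.2 (hT _ (s.finite_toSet.image _))).trans hω
    have hn : ∀ n, #(F n) ≤ max #B ℵ₀ := by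
      intro n
      induction n with
      | zero => exact le_max_left _ _
      | succ n ih => rw [hF]; exact hstep _ ih
    have hω : ℵ₀ ≤ max #B ℵ₀ := le_max_right _ _
    have := mk_iUnion_le_lift F
    simp only [lift_uzero, mk_nat, lift_aleph0] at this
    exact this.trans ((mul_le_mul' hω (ciSup_le' hn)).trans (mul_eq_self hω).le)

/-- There is a monotone closure under an operator that sends finite sets to countable sets, and
it does not increase cardinality beyond `ℵ₀`. -/
theorem exists_closure_operator {ι : Type u} (T : Set ι → Set ι)
    (hT : ∀ s, s.Finite → (T s).Countable) :
    ∃ cl : Set ι → Set ι, Monotone cl ∧ (∀ B, B ⊆ cl B) ∧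
      (∀ B, ∀ s ⊆ cl B, s.Finite → T s ⊆ cl B) ∧ ∀ B, #(cl B) ≤ max #B ℵ₀ := by
  -- Taking the least closed superset makes monotonicity immediate; any small closed superset bounds
  -- its size.
  refine ⟨fun B => ⋂₀ {C | B ⊆ C ∧ ∀ s ⊆ C, s.Finite → T s ⊆ C}, ?_, ?_, ?_, ?_⟩
  · exact fun B B' h => sInter_subset_sInter fun C hC => ⟨h.trans hC.1, hC.2⟩
  · exact fun B => subset_sInter fun C hC => hC.1
  · exact fun B s hs hfin => subset_sInter fun C hC =>
      hC.2 s (hs.trans (sInter_subset_of_mem hC)) hfin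
  · intro B
    obtain ⟨C, hBC, hC, hcard⟩ := exists_closed_superset T hT B
    refine le_trans (mk_le_mk_of_subset ?_) hcard
    exact sInter_subset_of_mem ⟨hBC, hC⟩

/-- An infinite subset of a well-order contains a strictly increasing sequence. -/
theorem exists_strictMono_of_infinite {α : Type*} [LinearOrder α] [WellFoundedLT α] {s : Set α}
    (hs : s.Infinite) : ∃ f : ℕ → α, StrictMono f ∧ ∀ n, f n ∈ s := by
  let g := hs.natEmbedding
  obtain ⟨e, he⟩ := exists_increasing_or_nonincreasing_subseq (· < ·) (fun n => (g n : α))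
  rcases he with he | he
  · exact ⟨fun n => g (e n), fun m n h => he m n h, fun n => (g (e n)).2⟩
  · exfalso
    have hanti : StrictAnti fun n => (g (e n) : α) := by
      intro m n hmn
      refine lt_of_le_of_ne (not_lt.1 (he m n hmn)) fun h => ?_
      exact hmn.ne' (e.injective (g.injective (Subtype.ext h)))
    exact (RelEmbedding.natGT (r := (· < ·)) (fun n => (g (e n) : α))
      fun n => hanti n.lt_succ_self).not_wellFounded wellFounded_lt

/-- If no sequence in a set `A x` avoids the countable sets attached by `T` to its finite initial
segments, then the index set splits into countable blocks of which each `A x` meets only finitely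
many. -/
theorem exists_countable_blocks {ι : Type u} {X : Type*} (A : X → Set ι) (T : Set ι → Set ι)
    (hT : ∀ s, s.Finite → (T s).Countable)
    (H : ∀ x (i : ℕ → ι), (∀ n, i n ∈ A x) → ∃ n, i (n + 1) ∈ T (i '' Iic n)) (S : Set ι) :
    ∃ (Γ : Type u) (b : ι → Γ), (∀ γ, {i | i ∈ S ∧ b i = γ}.Countable) ∧
      ∀ x, (b '' (S ∩ A x)).Finite := by
  classical
  obtain ⟨cl, hmono, hsub, hcl, hcard⟩ := exists_closure_operator T hT
  generalize hκ : #S = κ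
  induction κ using WellFoundedLT.induction generalizing S with
  | ind κ ih =>
  by_cases hS : S.Countable
  · refine ⟨PUnit, fun _ => PUnit.unit, fun γ => hS.mono fun i hi => hi.1, fun x => toFinite _⟩
  have hSω : ℵ₀ < #S := by
    rw [← not_le, le_aleph0_iff_set_countable]; exact hS
  -- In a well-order of least type, initial segments of `S`, hence their closures, are smaller than
  -- `S`.
  obtain ⟨_, _, hord⟩ := exists_ord_eq_type_lt S
  let B : S → Set ι := fun δ => Subtype.val '' Iic δ
  have hBmono : Monotone B := fun δ δ' h => image_mono (Iic_subset_Iic.2 h)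
  have hB : ∀ δ, #(cl (B δ)) < #S := by
    intro δ
    refine (hcard _).trans_lt (max_lt (mk_image_le.trans_lt ?_) hSω)
    rw [← Iio_insert]
    exact mk_insert_le.trans_lt
      (add_lt_of_lt hSω.le (mk_Iio_lt δ hord) (one_lt_aleph0.trans hSω))
  -- `ρ i` is the first initial segment whose closure captures `i`; its fibres are small enough for
  -- the induction hypothesis.
  have hρ : ∀ i : S, ∃ δ, i.1 ∈ cl (B δ) ∧ ∀ δ' < δ, i.1 ∉ cl (B δ') := by
    intro i
    obtain ⟨δ, hδ, hmin⟩ := (wellFounded_lt (α := S)).has_min {δ | i.1 ∈ cl (B δ)}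
      ⟨i, hsub _ ⟨i, self_mem_Iic, rfl⟩⟩
    exact ⟨δ, hδ, fun δ' h h' => hmin δ' h' h⟩
  choose ρ hρ hρmin using hρ
  have hpiece : ∀ δ : S, ∃ (Γ : Type u) (b : ι → Γ),
      (∀ γ, {i | i ∈ Subtype.val '' (ρ ⁻¹' {δ}) ∧ b i = γ}.Countable) ∧
      ∀ x, (b '' (Subtype.val '' (ρ ⁻¹' {δ}) ∩ A x)).Finite := by
    intro δ
    refine ih _ ?_ _ rfl
    rw [← hκ]
    refine (mk_le_mk_of_subset ?_).trans_lt (hB δ)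
    rintro _ ⟨i, rfl, rfl⟩
    exact hρ i
  choose Γ b hb hfin using hpiece
  let c : ι → Option (Σ δ, Γ δ) := fun i =>
    if h : i ∈ S then some ⟨ρ ⟨i, h⟩, b (ρ ⟨i, h⟩) i⟩ else none
  have hc : ∀ i : S, c i = some ⟨ρ i, b (ρ i) i⟩ := fun i => dif_pos i.2
  refine ⟨Option (Σ δ, Γ δ), c, ?_, ?_⟩
  · rintro (_ | ⟨δ, γ⟩)
    · refine countable_empty.mono ?_
      rintro i ⟨hi, h⟩
      rw [hc ⟨i, hi⟩] at h
      cases h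
    · refine (hb δ γ).mono ?_
      rintro i ⟨hi, h⟩
      rw [hc ⟨i, hi⟩, Option.some_inj] at h
      cases h
      exact ⟨⟨⟨i, hi⟩, rfl, rfl⟩, rfl⟩
  · intro x
    -- Otherwise choose `i n` in `A x` with `ρ (i n)` strictly increasing. The closure capturing `i
    -- 0, …, i n` is `T`-closed, so it already captures some `i (n + 1)`, against the minimality of
    -- `ρ`.
    have hρfin : (ρ '' {i | i.1 ∈ A x}).Finite := by
      by_contra hinf
      obtain ⟨f, hf, hmem⟩ := exists_strictMono_of_infinite hinf
      choose i hi hif using hmem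
      obtain ⟨n, hn⟩ := H x (fun n => (i n).1) hi
      refine hρmin (i (n + 1)) (f n) ?_ (hcl _ _ ?_ ((finite_Iic n).image _) hn)
      · rw [hif]; exact hf n.lt_succ_self
      · rintro _ ⟨m, hm, rfl⟩
        refine hmono (hBmono (hf.monotone hm)) ?_
        rw [← hif]
        exact hρ (i m)
    refine (hρfin.biUnion fun δ _ =>
      (hfin δ x).image fun γ => (some ⟨δ, γ⟩ : Option (Σ δ, Γ δ))).subset ?_
    rintro _ ⟨i, ⟨hi, hx⟩, rfl⟩
    rw [hc ⟨i, hi⟩]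
    exact mem_biUnion (mem_image_of_mem ρ (show (⟨i, hi⟩ : S) ∈ {i : S | i.1 ∈ A x} from hx))
      ⟨_, ⟨i, ⟨⟨⟨i, hi⟩, rfl, rfl⟩, hx⟩, rfl⟩, rfl⟩

end Combinatorics

/-! ### Open filtration by separable layers, and rank of compact sets -/

section Rank

variable {K : Type u} [TopologicalSpace K]

/-- The increasing filtration by open sets in which, at each stage, all open sets are added
that are separable modulo the earlier stages. -/
def scatteredFiltration (K : Type u) [TopologicalSpace K] (α : Ordinal.{u}) : Set K :=
  ⋃₀ {U | IsOpen U ∧ IsSeparable (U \ ⋃ β : Iio α, scatteredFiltration K β.1)}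
termination_by α
decreasing_by exact β.2

theorem scatteredFiltration_eq (α : Ordinal.{u}) : scatteredFiltration K α =
    ⋃₀ {U | IsOpen U ∧ IsSeparable (U \ ⋃ β : Iio α, scatteredFiltration K β.1)} := by
  rw [scatteredFiltration]

theorem isOpen_scatteredFiltration (α : Ordinal.{u}) : IsOpen (scatteredFiltration K α) := by
  rw [scatteredFiltration_eq]
  exact isOpen_sUnion fun U hU => hU.1

theorem scatteredFiltration_mono : Monotone (scatteredFiltration K) := by
  intro α β h
  rw [scatteredFiltration_eq α, scatteredFiltration_eq β]
  exact sUnion_subset_sUnion fun U hU => ⟨hU.1, hU.2.mono (sdiff_subset_sdiff_right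
    (iUnion_subset fun γ => subset_iUnion_of_subset ⟨γ.1, γ.2.trans_le h⟩ Subset.rfl))⟩

/-- If `U` meets the uncovered part of `X` in a nonempty separable set, then `X ∩ U` enters at any
stage past one chosen stage for each covered point. -/
theorem subset_iUnion_scatteredFiltration {X : Set K} (hX : IsOpen X)
    (hsc : ∀ A ⊆ X, A.Nonempty → ∃ U, IsOpen U ∧ (A ∩ U).Nonempty ∧ IsSeparable (A ∩ U)) :
    X ⊆ ⋃ α : Ordinal.{u}, scatteredFiltration K α := by
  by_contra hne
  obtain ⟨U, hU, ⟨x, ⟨hxX, hx⟩, hxU⟩, hsep⟩ := hsc (X \ ⋃ α : Ordinal.{u}, scatteredFiltration K α)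
    sdiff_subset (sdiff_nonempty.2 hne)
  have hall : ∀ y : K, ∃ α : Ordinal.{u},
      y ∈ (⋃ α : Ordinal.{u}, scatteredFiltration K α) → y ∈ scatteredFiltration K α := by
    intro y
    by_cases hy : y ∈ ⋃ α : Ordinal.{u}, scatteredFiltration K α
    · obtain ⟨α, hα⟩ := mem_iUnion.1 hy
      exact ⟨α, fun _ => hα⟩
    · exact ⟨0, fun h => absurd h hy⟩
  choose α hα using hall
  let σ : Ordinal.{u} := Order.succ (⨆ y, α y)
  refine hx (mem_iUnion.2 ⟨σ, ?_⟩)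
  rw [scatteredFiltration_eq]
  refine mem_sUnion.2 ⟨X ∩ U, ⟨hX.inter hU, hsep.mono ?_⟩, hxX, hxU⟩
  rintro y ⟨⟨hyX, hyU⟩, hy⟩
  refine ⟨⟨hyX, fun h => hy (mem_iUnion.2 ⟨⟨α y, ?_⟩, hα y h⟩)⟩, hyU⟩
  exact Order.lt_succ_of_le (Ordinal.le_iSup α y)

/-- The rank of a set: the first stage of the filtration that contains it. -/
noncomputable def scatteredRank (Y : Set K) : Ordinal.{u} :=
  sInf {α | Y ⊆ scatteredFiltration K α}

/-- A compact set of a given rank has a separable top level, and its compact parts that miss the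
top level have smaller rank. -/
theorem exists_countable_scatteredRank_lt {Y : Set K} (hY : IsCompact Y)
    (hcov : Y ⊆ ⋃ α : Ordinal.{u}, scatteredFiltration K α) :
    ∃ c : Set K, c.Countable ∧ ∀ V, IsClopen V → Disjoint V c → (Y ∩ V).Nonempty →
      scatteredRank (Y ∩ V) < scatteredRank Y := by
  have hdir : ∀ α : Ordinal.{u}, Directed (· ⊆ ·) fun β : Iio α => scatteredFiltration K β.1 :=
    fun α => (scatteredFiltration_mono.comp (Subtype.mono_coe _)).directed_le
  have hne : {α | Y ⊆ scatteredFiltration K α}.Nonempty :=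
    hY.elim_directed_cover _ isOpen_scatteredFiltration hcov scatteredFiltration_mono.directed_le
  have hr : Y ⊆ scatteredFiltration K (scatteredRank Y) := csInf_mem hne
  set r := scatteredRank Y
  set G := ⋃ β : Iio r, scatteredFiltration K β.1 with hG
  have hGo : IsOpen G := isOpen_iUnion fun β => isOpen_scatteredFiltration _
  have hsep : IsSeparable (Y \ G) := by
    have hc : IsCompact (Y \ G) := hY.diff hGo
    have hsub : Y \ G ⊆ scatteredFiltration K r := sdiff_subset.trans hr
    rw [scatteredFiltration_eq] at hsub
    rw [sUnion_eq_biUnion] at hsub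
    obtain ⟨t, ht, hfin, hcover⟩ := hc.elim_finite_subcover_image (fun U hU => hU.1) hsub
    have := hfin.to_subtype
    refine (IsSeparable.iUnion fun U : t => (ht U.2).2).mono fun y hy => ?_
    obtain ⟨U, hU, hyU⟩ := mem_iUnion₂.1 (hcover hy)
    exact mem_iUnion.2 ⟨⟨U, hU⟩, hyU, hy.2⟩
  obtain ⟨c, hc, hcl⟩ := hsep
  refine ⟨c, hc, fun V hV hVc hne' => ?_⟩
  have hsub : Y ∩ V ⊆ G := by
    rintro y ⟨hyY, hyV⟩
    by_contra hyG
    obtain ⟨z, hzV, hzc⟩ := mem_closure_iff.1 (hcl ⟨hyY, hyG⟩) V hV.isOpen hyV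
    exact hVc.le_bot ⟨hzV, hzc⟩
  -- Nonemptiness of `Y ∩ V` excludes `r = 0`, where no smaller rank exists.
  have : Nonempty (Iio r) := by
    obtain ⟨y, hy⟩ := hne'
    obtain ⟨β, -⟩ := mem_iUnion.1 (hsub hy)
    exact ⟨β⟩
  obtain ⟨β, hβ⟩ := (hY.inter_right hV.isClosed).elim_directed_cover _
    (fun β : Iio r => isOpen_scatteredFiltration β.1) hsub (hdir r)
  exact (csInf_le' hβ).trans_lt β.2

end Rank

/-! ### Block-point-finiteness and point-finite refinements -/

section Blocks

variable {K : Type u} [TopologicalSpace K]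

/-- Separability is all the rank argument needs from second-countability, and it passes from `W` to
`K` along the inclusion. -/
theorem IsMScattered.exists_isSeparable {W : Set K} (h : IsMScattered W) (hW : IsOpen W)
    {A : Set K} (hA : (A ∩ W).Nonempty) :
    ∃ U, IsOpen U ∧ (A ∩ U).Nonempty ∧ IsSeparable (A ∩ U) := by
  obtain ⟨x, hxA, hxW⟩ := hA
  obtain ⟨_, ⟨O, hO, rfl⟩, ⟨y, hyA, hyO⟩, hsc⟩ := h (Subtype.val ⁻¹' A) ⟨⟨x, hxW⟩, hxA⟩
  refine ⟨W ∩ O, hW.inter hO, ⟨y, hyA, y.2, hyO⟩, ?_⟩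
  refine ((IsSeparable.of_subtype _).image continuous_subtype_val :
    IsSeparable (Subtype.val '' (Subtype.val ⁻¹' A ∩ Subtype.val ⁻¹' O : Set W))).mono ?_
  rintro z ⟨hzA, hzW, hzO⟩
  exact ⟨⟨z, hzW⟩, ⟨hzA, hzO⟩, rfl⟩

theorem IsMScattered.subtype (h : IsMScattered K) (W : Set K) : IsMScattered W := by
  intro A hA
  obtain ⟨U, hU, ⟨_, ⟨x, hxA, rfl⟩, hxU⟩, hsc⟩ := h (Subtype.val '' A) (hA.image _)
  refine ⟨Subtype.val ⁻¹' U, hU.preimage continuous_subtype_val, ⟨x, hxA, hxU⟩, ?_⟩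
  let f : (A ∩ Subtype.val ⁻¹' U : Set W) → (Subtype.val '' A ∩ U : Set K) :=
    fun z => ⟨z.1.1, ⟨z.1, z.2.1, rfl⟩, z.2.2⟩
  have hf : IsInducing f := by
    refine IsInducing.of_comp (g := Subtype.val) ?_ continuous_subtype_val ?_
    · exact (continuous_subtype_val.comp continuous_subtype_val).subtype_mk _
    · exact (IsInducing.subtypeVal (t := W)).comp IsInducing.subtypeVal
  exact hf.secondCountableTopology

/-- A point-countable family of M-scattered clopen subsets of a compact space is
block-point-finite. -/
theorem IsPointCountable.isBlockPointFinite [CompactSpace K] {𝒰 : Set (Set K)}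
    (h𝒰 : IsPointCountable 𝒰) (hU : ∀ U ∈ 𝒰, IsClopen U ∧ IsMScattered U) :
    IsBlockPointFinite 𝒰 := by
  have hcov : ⋃₀ 𝒰 ⊆ ⋃ α : Ordinal.{u}, scatteredFiltration K α := by
    refine subset_iUnion_scatteredFiltration (isOpen_sUnion fun U h => (hU U h).1.isOpen) ?_
    rintro A hA ⟨x, hx⟩
    obtain ⟨W, hW, hxW⟩ := hA hx
    exact (hU W hW).2.exists_isSeparable (hU W hW).1.isOpen ⟨x, hx, hxW⟩
  have htop : ∀ Y : Set K, ∃ c : Set K, c.Countable ∧ (IsCompact Y → Y ⊆ ⋃₀ 𝒰 →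
      ∀ V, IsClopen V → Disjoint V c → (Y ∩ V).Nonempty →
        scatteredRank (Y ∩ V) < scatteredRank Y) := by
    intro Y
    by_cases hY : IsCompact Y ∧ Y ⊆ ⋃₀ 𝒰
    · obtain ⟨c, hc, h⟩ := exists_countable_scatteredRank_lt hY.1 (hY.2.trans hcov)
      exact ⟨c, hc, fun _ _ => h⟩
    · exact ⟨∅, countable_empty, fun h1 h2 => absurd ⟨h1, h2⟩ hY⟩
  choose c hc hlt using htop
  have hT : ∀ s : Set (Set K), s.Finite →
      {U | U ∈ 𝒰 ∧ (U ∩ c (⋂₀ s)).Nonempty}.Countable := by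
    intro s _
    refine ((hc (⋂₀ s)).biUnion fun x _ => h𝒰 x).mono ?_
    rintro U ⟨h1, x, hxU, hxc⟩
    exact mem_biUnion hxc ⟨h1, hxU⟩
  have H : ∀ (x : K) (i : ℕ → Set K), (∀ n, i n ∈ {U | U ∈ 𝒰 ∧ x ∈ U}) →
      ∃ n, i (n + 1) ∈ {U | U ∈ 𝒰 ∧ (U ∩ c (⋂₀ (i '' Iic n))).Nonempty} := by
    -- A counterexample would give finite intersections of strictly decreasing rank, all containing
    -- `x`.
    intro x i hi
    by_contra! hT
    let Y : ℕ → Set K := fun n => ⋂₀ (i '' Iic n)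
    have hsucc : ∀ n, Y (n + 1) = Y n ∩ i (n + 1) := by
      intro n
      have : Iic (n + 1) = insert (n + 1) (Iic n) := (Order.Iic_succ n)
      simp only [Y, this, image_insert_eq, sInter_insert, inter_comm]
    have hx : ∀ n, x ∈ Y n := by
      rintro n _ ⟨m, -, rfl⟩
      exact (hi m).2
    have hsub : ∀ n, Y n ⊆ ⋃₀ 𝒰 := fun n y hy =>
      ⟨i n, (hi n).1, hy _ ⟨n, self_mem_Iic, rfl⟩⟩
    have hcomp : ∀ n, IsCompact (Y n) := by
      intro n
      refine (isClosed_sInter ?_).isCompact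
      rintro _ ⟨m, -, rfl⟩
      exact (hU _ (hi m).1).1.isClosed
    have hdec : ∀ n, scatteredRank (Y (n + 1)) < scatteredRank (Y n) := by
      intro n
      rw [hsucc]
      refine hlt _ (hcomp n) (hsub n) _ (hU _ (hi _).1).1 ?_ ⟨x, hx n, (hi _).2⟩
      rw [Set.disjoint_iff_inter_eq_empty, ← Set.not_nonempty_iff_eq_empty]
      exact fun h => hT n ⟨(hi _).1, h⟩
    exact (RelEmbedding.natGT (r := (· < ·)) (fun n => scatteredRank (Y n)) hdec).not_wellFounded
      wellFounded_lt
  obtain ⟨Γ, b, hb, hfin⟩ := exists_countable_blocks (fun x : K => {U | U ∈ 𝒰 ∧ x ∈ U})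
    (fun s => {U | U ∈ 𝒰 ∧ (U ∩ c (⋂₀ s)).Nonempty}) hT H 𝒰
  refine ⟨Γ, fun γ => {U | U ∈ 𝒰 ∧ b U = γ}, ?_, hb, fun x => (hfin x).subset ?_⟩
  · ext U
    simp
  · rintro γ ⟨U, ⟨h1, rfl⟩, h2⟩
    exact ⟨U, ⟨h1, h1, h2⟩, rfl⟩

/-- A block-point-finite family of clopen sets has a point-finite clopen refinement with the same
union. -/
theorem IsBlockPointFinite.exists_pointFinite_refinement {𝒰 : Set (Set K)}
    (h𝒰 : IsBlockPointFinite 𝒰) (hU : ∀ U ∈ 𝒰, IsClopen U) :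
    ∃ 𝒱 : Set (Set K), (∀ V ∈ 𝒱, IsClopen V) ∧ IsPointFinite 𝒱 ∧ Refines 𝒱 𝒰 ∧
      ⋃₀ 𝒰 = ⋃₀ 𝒱 := by
  obtain ⟨Γ, B, rfl, hB, hfin⟩ := h𝒰
  choose e he using fun γ => (countable_iff_exists_injOn.1 (hB γ))
  -- Only finitely many members precede `U` in its block, so `D γ U` stays clopen; within a block
  -- these sets are disjoint, so each block that reaches `x` contributes at most one.
  let D : Γ → Set K → Set K := fun γ U => U \ ⋃₀ {U' | U' ∈ B γ ∧ e γ U' < e γ U}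
  refine ⟨{V | ∃ γ, ∃ U ∈ B γ, D γ U = V}, ?_, ?_, ?_, Subset.antisymm ?_ ?_⟩
  · rintro _ ⟨γ, U, hUB, rfl⟩
    refine (hU U (mem_iUnion.2 ⟨γ, hUB⟩)).diff ?_
    rw [sUnion_eq_biUnion]
    refine Finite.isClopen_biUnion ?_ fun U' h => hU U' (mem_iUnion.2 ⟨γ, h.1⟩)
    refine Finite.of_finite_image ((finite_Iio (e γ U)).subset ?_)
      ((he γ).mono fun U' h => h.1)
    rintro _ ⟨U', h, rfl⟩
    exact h.2
  · intro x
    refine ((hfin x).biUnion (t := fun γ => {V | ∃ U ∈ B γ, D γ U = V ∧ x ∈ V})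
      fun γ _ => Subsingleton.finite ?_).subset ?_
    · rintro _ ⟨U, hUB, rfl, hx⟩ _ ⟨U', hUB', rfl, hx'⟩
      have h : e γ U = e γ U' := by
        refine le_antisymm (not_lt.1 fun h => ?_) (not_lt.1 fun h => ?_)
        · exact hx.2 ⟨U', ⟨hUB', h⟩, hx'.1⟩
        · exact hx'.2 ⟨U, ⟨hUB, h⟩, hx.1⟩
      rw [he γ hUB hUB' h]
    · rintro _ ⟨⟨γ, U, hUB, rfl⟩, hx⟩
      exact mem_biUnion (show γ ∈ {γ | x ∈ ⋃₀ B γ} from ⟨U, hUB, hx.1⟩) ⟨U, hUB, rfl, hx⟩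
  · rintro _ ⟨γ, U, hUB, rfl⟩
    exact ⟨U, mem_iUnion.2 ⟨γ, hUB⟩, sdiff_subset⟩
  · rintro x ⟨U, hUB, hx⟩
    obtain ⟨γ, hUB⟩ := mem_iUnion.1 hUB
    obtain ⟨W, ⟨hW, hxW⟩, hmin⟩ := (measure (e γ)).wf.has_min {W | W ∈ B γ ∧ x ∈ W} ⟨U, hUB, hx⟩
    exact ⟨_, ⟨γ, W, hW, rfl⟩, hxW, fun ⟨W', h, hx'⟩ => hmin W' ⟨h.1, hx'⟩ h.2⟩
  · rintro x ⟨_, ⟨γ, U, hUB, rfl⟩, hx⟩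
    exact ⟨U, mem_iUnion.2 ⟨γ, hUB⟩, hx.1⟩

end Blocks

/-! ### Point-countable separating families in Corson compacta -/

section Corson

variable {K : Type u} [TopologicalSpace K]

theorem IsZeroDimensional.exists_isClopen_between (h : IsZeroDimensional K) {C O : Set K}
    (hC : IsCompact C) (hO : IsOpen O) (hCO : C ⊆ O) : ∃ V, IsClopen V ∧ C ⊆ V ∧ V ⊆ O := by
  refine hC.induction_on (p := fun s => ∃ V, IsClopen V ∧ s ⊆ V ∧ V ⊆ O) ?_ ?_ ?_ ?_
  · exact ⟨∅, isClopen_empty, Subset.rfl, empty_subset _⟩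
  · rintro s t hst ⟨V, hV, htV, hVO⟩
    exact ⟨V, hV, hst.trans htV, hVO⟩
  · rintro s t ⟨V, hV, hsV, hVO⟩ ⟨W, hW, htW, hWO⟩
    exact ⟨V ∪ W, hV.union hW, union_subset_union hsV htW, union_subset hVO hWO⟩
  · intro x hx
    obtain ⟨V, hV, hxV, hVO⟩ := IsTopologicalBasis.exists_subset_of_mem_open h (hCO hx) hO
    exact ⟨V, mem_nhdsWithin_of_mem_nhds (hV.isOpen.mem_nhds hxV), V, hV, Subset.rfl, hVO⟩

/-- A zero-dimensional Corson compact space has a point-countable `T₀`-separating family of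
clopen sets. -/
theorem IsCorsonCompact.exists_pointCountable_t0Separating (hK : IsCorsonCompact.{u, v} K)
    (h0 : IsZeroDimensional K) :
    ∃ 𝒰 : Set (Set K), (∀ U ∈ 𝒰, IsClopen U) ∧ IsT0Separating 𝒰 ∧ IsPointCountable 𝒰 := by
  obtain ⟨_, Γ, h, hemb, hrange⟩ := hK
  have hcont : ∀ γ, Continuous fun x => (h x γ : ℝ) := fun γ =>
    continuous_subtype_val.comp ((continuous_apply γ).comp hemb.continuous)
  have hV : ∀ (γ : Γ) (p q : ℚ), ∃ V : Set K, IsClopen V ∧ (p < q →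
      {x | (q : ℝ) ≤ h x γ} ⊆ V ∧ V ⊆ {x | (p : ℝ) < h x γ}) := by
    intro γ p q
    by_cases hpq : p < q
    · obtain ⟨V, hV, h1, h2⟩ := h0.exists_isClopen_between
        (isClosed_le (continuous_const (y := (q : ℝ))) (hcont γ)).isCompact
        (isOpen_lt (continuous_const (y := (p : ℝ))) (hcont γ))
        (fun x hx => lt_of_lt_of_le (b := (q : ℝ)) (Rat.cast_lt.2 hpq) hx)
      exact ⟨V, hV, fun _ => ⟨h1, h2⟩⟩
    · exact ⟨∅, isClopen_empty, fun h => absurd h hpq⟩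
  choose V hV hsub using hV
  -- The condition `0 ≤ p` puts `V γ p q` inside `{x | h x γ ≠ 0}`, so countable supports give
  -- point-countability.
  refine ⟨{U | ∃ γ p q, 0 ≤ p ∧ p < q ∧ V γ p q = U}, ?_, ?_, ?_⟩
  · rintro _ ⟨γ, p, q, -, -, rfl⟩
    exact hV γ p q
  · have key : ∀ x y γ, h x γ < h y γ → ∃ U ∈ {U | ∃ γ p q, 0 ≤ p ∧ p < q ∧ V γ p q = U},
        y ∈ U ∧ x ∉ U := by
      intro x y γ hxy
      obtain ⟨q, hq, hq'⟩ := exists_rat_btwn (Subtype.coe_lt_coe.2 hxy)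
      obtain ⟨p, hp, hp'⟩ := exists_rat_btwn hq
      have hpq : p < q := Rat.cast_lt.1 hp'
      have hp0 : 0 ≤ p := by
        have : (0 : ℝ) ≤ p := (h x γ).2.1.trans hp.le
        exact_mod_cast this
      exact ⟨_, ⟨γ, p, q, hp0, hpq, rfl⟩, (hsub γ p q hpq).1 hq'.le,
        fun hx => hp.not_gt ((hsub γ p q hpq).2 hx)⟩
    intro x y hxy
    obtain ⟨γ, hγ⟩ := Function.ne_iff.1 (hemb.injective.ne hxy)
    rcases lt_or_gt_of_ne hγ with hlt | hlt
    · obtain ⟨U, hU, h1, h2⟩ := key x y γ hlt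
      exact ⟨U, hU, Or.inr ⟨h1, h2⟩⟩
    · obtain ⟨U, hU, h1, h2⟩ := key y x γ hlt
      exact ⟨U, hU, Or.inl ⟨h1, h2⟩⟩
  · intro x
    have hx : {γ | h x γ ≠ 0}.Countable := hrange (mem_range_self x)
    refine (hx.biUnion fun γ _ => countable_range fun pq : ℚ × ℚ => V γ pq.1 pq.2).mono ?_
    rintro _ ⟨⟨γ, p, q, hp, hpq, rfl⟩, hxV⟩
    refine mem_biUnion (x := γ) (fun h0 => ?_) ⟨(p, q), rfl⟩
    have h1 : (p : ℝ) < h x γ := (hsub γ p q hpq).2 hxV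
    have h2 : (0 : ℝ) ≤ p := by exact_mod_cast hp
    rw [h0] at h1
    exact h1.not_ge h2

end Corson

theorem mainTheorem10 {K : Type u} [TopologicalSpace K] [CompactSpace K] [T2Space K] :
    (IsZeroDimensional K → IsMScattered K → IsCorsonCompact.{u, v} K →
      ∃ 𝒰 : Set (Set K), (∀ U ∈ 𝒰, IsClopen U) ∧ IsT0Separating 𝒰 ∧ IsBlockPointFinite 𝒰) ∧
    (∀ 𝒰 : Set (Set K), IsPointCountable 𝒰 → (∀ U ∈ 𝒰, IsClopen U ∧ IsMScattered U) →
      ∃ 𝒱 : Set (Set K), (∀ V ∈ 𝒱, IsClopen V) ∧ IsPointFinite 𝒱 ∧ Refines 𝒱 𝒰 ∧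
        ⋃₀ 𝒰 = ⋃₀ 𝒱) := by
  refine ⟨fun h0 hM hC => ?_, fun 𝒰 h𝒰 hU => ?_⟩
  · obtain ⟨𝒰, hU, hsep, hpc⟩ := hC.exists_pointCountable_t0Separating h0
    exact ⟨𝒰, hU, hsep, hpc.isBlockPointFinite fun U h => ⟨hU U h, hM.subtype U⟩⟩
  · exact (h𝒰.isBlockPointFinite hU).exists_pointFinite_refinement fun U h => (hU U h).1
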